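/- For a finite abelian group $A$, let $f(A)$ be the least integer $n$ such that for every map $w$ from the arcs of the complete digraph on $n$ vertices to $A$ there is a directed cycle $C$ with $\sum_{e \in E(C)} w(e) = 0$. Here the complete digraph has exactly one arc from $u$ to $v$ for every ordered pair $(u,v)$ of distinct vertices and no loops, and a directed cycle has at least two vertices, all distinct (two opposite arcs form a directed cycle of length two). Let $p$ be a prime and let $k \ge 1$ be an integer. Then $f(\mathbb{Z}_p^k)$ exists and $$f(\mathbb{Z}_p^k) \le 600\, p \cdot k\, (\log_2(10k))^2,$$ where $\mathbb{Z}_p = \mathbb{Z}/p\mathbb{Z}$. -/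

import Mathlib

/-- The weight of the directed closed walk `v₀ → v₁ → ⋯ → v_{m-1} → v₀` given by the list
`c = [v₀, …, v_{m-1}]`: the sum of `w vᵢ vᵢ₊₁` over the arcs, with indices modulo `m`. -/
def cycleWeight {V A : Type*} [AddCommGroup A] (w : V → V → A) (c : List V) : A :=
  (List.zipWith w c (c.rotate 1)).sum

/-- `c` lists, in cyclic order, the vertices of a directed cycle of total weight zero in the
complete digraph on `V` (one arc from `u` to `v` for every ordered pair of distinct vertices, no
loops). The vertices are distinct and there are at least two of them; two antiparallel arcs
form a directed cycle. An arc weighting is given as a function `w : V → V → A`; its values on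
the diagonal are never used, because the arcs of such a cycle join distinct vertices. -/
def IsZeroSumCycle {V A : Type*} [AddCommGroup A] (w : V → V → A) (c : List V) : Prop :=
  2 ≤ c.length ∧ c.Nodup ∧ cycleWeight w c = 0

/-- Every `A`-weighting of the arcs of the complete digraph on `n` vertices has a zero-sum
directed cycle. -/
def ForcesZeroSumCycle (A : Type*) [AddCommGroup A] (n : ℕ) : Prop :=
  ∀ w : Fin n → Fin n → A, ∃ c : List (Fin n), IsZeroSumCycle w c

/-- `f(A)`: the least `n` such that every `A`-weighting of the arcs of the complete digraph on
`n` vertices has a zero-sum directed cycle. -/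
noncomputable def zeroSumCycleNumber (A : Type*) [AddCommGroup A] : ℕ :=
  sInf {n : ℕ | ForcesZeroSumCycle A n}

/-!
Consider the *detours* of the digraph: an arc `u → v` together with a path `u → x → v`. The gain
of a detour is `w u x + w x v - w u v`. A cycle that runs through vertex-disjoint detours one after
the other offers an independent choice at each of them, and the available weights are a fixed base
weight plus the subset sums of the gains. So a zero-sum cycle exists once there are a subspace `U`
that contains all gains, hence all cycle weights (`exists_potential`,
`cycleWeight_mem_of_potential`), and disjoint detours whose gains have all of `U` as subset sums.

Two results provide these detours. The first is about additive bases (`exists_subset_sum_eq`): with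
`j ≈ p log (2k)`, the subset sums of `2j` spanning families of a `k`-dimensional space over `ℤ/p`
are the whole space. It follows from a discrete Brunn–Minkowski type inequality
(`pow_le_card_add_cube`), `|A + {0,1}ᵏ|^(1/k) ≥ (1 - 1/p) |A|^(1/k) + 1` for nonempty `A ⊆ (ℤ/p)ᵏ`,
and from the fact that two sets larger than half of a group have sumset everything. The second is a
Haxell-type matching theorem for hyperedges with vector labels
(`exists_disjoint_spanning_classes`): disjoint edges forming `m` spanning classes exist unless, for
some proper subspace `U'`, the edges with labels outside `U'` are covered by few vertices, at most
a constant times `m · codim U'`. In that case these vertices are deleted and `U` is replaced by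
`U'`. The codimensions add up to at most `k`, so at most `12 j k` vertices are deleted altogether,
and the procedure ends with a subspace to which the matching theorem applies, or with the zero
subspace, where every cycle has weight zero.
-/

open Module

/-! ### Sumsets with the discrete cube -/

section

open scoped Pointwise

/-- Going once around the cycle `ℤ/p`, the function `h` has to climb from its value at `b` to its
value at `a`, and `∑ max (h x) (h (x - 1))` exceeds `∑ h x` by at least that climb. For the
indicator of a nonempty proper set `S` this says `|S + {0, 1}| ≥ |S| + 1`. -/
theorem sum_add_sub_le_sum_max {p : ℕ} [NeZero p] (h : ZMod p → ℝ) (a b : ZMod p) :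
    ∑ x, h x + (h a - h b) ≤ ∑ x, max (h x) (h (x - 1)) := by
  have hshift : ∑ x, h x = ∑ x, h (x - 1) :=
    ((Equiv.subRight (1 : ZMod p)).sum_comp h).symm
  have hpos : ∑ x, max (h x) (h (x - 1)) = ∑ x, h x + ∑ x, max (h x - h (x - 1)) 0 := by
    rw [hshift, ← Finset.sum_add_distrib]
    refine Finset.sum_congr rfl fun x _ => ?_
    rw [← max_add_add_left]
    simp
  have htele : h a - h b =
      ∑ i ∈ Finset.range (a - b).val, (h (b + (i + 1 : ℕ)) - h (b + (i : ℕ))) := by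
    rw [Finset.sum_range_sub (fun i : ℕ => h (b + (i : ZMod p)))]
    simp
  have hinj : Set.InjOn (fun i : ℕ => b + ((i + 1 : ℕ) : ZMod p))
      (Finset.range (a - b).val : Set ℕ) := by
    intro i hi j hj hij
    simp only [Finset.coe_range, Set.mem_Iio] at hi hj
    have hlt := ZMod.val_lt (a - b)
    have hij' : (i : ZMod p) = (j : ZMod p) := by
      simpa using hij
    have := congrArg ZMod.val hij'
    rwa [ZMod.val_cast_of_lt (hi.trans hlt), ZMod.val_cast_of_lt (hj.trans hlt)] at this
  rw [hpos, htele]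
  gcongr
  calc ∑ i ∈ Finset.range (a - b).val, (h (b + (i + 1 : ℕ)) - h (b + (i : ℕ)))
      ≤ ∑ i ∈ Finset.range (a - b).val,
          max (h (b + (i + 1 : ℕ)) - h (b + (i + 1 : ℕ) - 1)) 0 := by
        refine Finset.sum_le_sum fun i _ => ?_
        have : b + ((i + 1 : ℕ) : ZMod p) - 1 = b + (i : ℕ) := by push_cast; ring
        rw [this]
        exact le_max_left _ _
    _ = ∑ x ∈ (Finset.range (a - b).val).image (fun i : ℕ => b + ((i + 1 : ℕ) : ZMod p)),
          max (h x - h (x - 1)) 0 := by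
        rw [Finset.sum_image hinj]
    _ ≤ ∑ x, max (h x - h (x - 1)) 0 :=
        Finset.sum_le_sum_of_subset_of_nonneg (Finset.subset_univ _)
          fun x _ _ => le_max_right _ _

/-- The previous inequality with `h b` at most the average of `h`. It trades the wrap-around term
for the factor `1 - 1 / p`, which leaves an expression that weighted AM-GM can handle. -/
theorem mul_sum_add_le_sum_max {p : ℕ} [NeZero p] (h : ZMod p → ℝ) (a : ZMod p) :
    (1 - 1 / (p : ℝ)) * ∑ x, h x + h a ≤ ∑ x, max (h x) (h (x - 1)) := by
  have hp : (p : ℝ) ≠ 0 := NeZero.ne _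
  obtain ⟨b, -, hb⟩ : ∃ b ∈ (Finset.univ : Finset (ZMod p)), h b ≤ (∑ x, h x) / p := by
    refine Finset.exists_le_of_sum_le Finset.univ_nonempty ?_
    simp [ZMod.card, mul_div_cancel₀, hp]
  have := sum_add_sub_le_sum_max h a b
  calc _ = ∑ x, h x + (h a - (∑ x, h x) / p) := by ring
    _ ≤ _ := by linarith

/-- The discrete cube `{0, 1}ᵏ` inside `(ℤ/p)ᵏ`. -/
def zeroOneCube (p k : ℕ) : Finset (Fin k → ZMod p) :=
  Fintype.piFinset fun _ => {0, 1}

/-- The section of `A` over the value `x` of the first coordinate. -/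
def firstCoordSection {p k : ℕ} [NeZero p] (A : Finset (Fin (k + 1) → ZMod p)) (x : ZMod p) :
    Finset (Fin k → ZMod p) :=
  Finset.univ.filter fun y => (Fin.cons x y : Fin (k + 1) → ZMod p) ∈ A

theorem sum_card_firstCoordSection {p k : ℕ} [NeZero p] (A : Finset (Fin (k + 1) → ZMod p)) :
    ∑ x, (firstCoordSection A x).card = A.card := by
  classical
  have : A.card = ∑ z, if z ∈ A then 1 else 0 := by simp
  rw [this, ← (Fin.consEquiv fun _ : Fin (k + 1) => ZMod p).sum_comp, Fintype.sum_prod_type]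
  refine Finset.sum_congr rfl fun x _ => ?_
  rw [firstCoordSection, Finset.card_filter]
  refine Finset.sum_congr rfl fun y _ => ?_
  rfl

theorem firstCoordSection_add_subset {p k : ℕ} [NeZero p] (A : Finset (Fin (k + 1) → ZMod p))
    (x c : ZMod p) (hc : c ∈ ({0, 1} : Finset (ZMod p))) :
    firstCoordSection A (x - c) + zeroOneCube p k ⊆
      firstCoordSection (A + zeroOneCube p (k + 1)) x := by
  intro y hy
  obtain ⟨u, hu, v, hv, rfl⟩ := Finset.mem_add.1 hy
  simp only [firstCoordSection, Finset.mem_filter, Finset.mem_univ, true_and] at hu ⊢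
  refine Finset.mem_add.2 ⟨_, hu, Fin.cons c v, ?_, ?_⟩
  · simp only [zeroOneCube, Fintype.mem_piFinset] at hv ⊢
    intro i
    refine Fin.cases ?_ (fun i => ?_) i
    · simpa using hc
    · simpa using hv i
  · funext i
    refine Fin.cases ?_ (fun i => ?_) i <;> simp

/-- A tensorizable form of `pow_le_card_add_cube`. The exponent `s` and the constant `L / r ^ s` are
those of the tangent at `τ = r`: weighted AM-GM gives `(L / r ^ s) * τ ^ s ≤ l * τ + 1` for all
`τ ≥ 0`, with equality at `τ = r`. Multiplicative bounds of this shape survive the induction on `k`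
that slices `A` along the first coordinate. -/
theorem rpow_card_le_card_add_cube {p : ℕ} (hp : 2 ≤ p) {r : ℝ} (hr : 0 < r) {l L s : ℝ}
    (hl : l = 1 - 1 / (p : ℝ)) (hL : L = l * r + 1) (hs : s = l * r / L) (k : ℕ)
    (A : Finset (Fin k → ZMod p)) :
    (L / r ^ s) ^ k * (A.card : ℝ) ^ s ≤ ((A + zeroOneCube p k).card : ℝ) := by
  have : NeZero p := ⟨by omega⟩
  have hl0 : 0 < l := by
    have : (2 : ℝ) ≤ p := by exact_mod_cast hp
    rw [hl, sub_pos, div_lt_one] <;> linarith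
  have hL0 : 0 < L := by rw [hL]; positivity
  have hs0 : 0 < s := by rw [hs]; positivity
  have hs1 : 1 - s = 1 / L := by
    rw [hs, eq_div_iff hL0.ne', sub_mul, div_mul_cancel₀ _ hL0.ne', hL]; ring
  have hs1' : 0 < 1 - s := by rw [hs1]; positivity
  have hC : 0 < L / r ^ s := by positivity
  induction k with
  | zero =>
    have hcube : zeroOneCube p 0 = {0} := by
      ext x
      simp only [zeroOneCube, Fintype.mem_piFinset, Finset.mem_singleton, Subsingleton.elim x 0,
        IsEmpty.forall_iff]
    rw [hcube, pow_zero, one_mul, Finset.singleton_zero, add_zero]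
    have hcard : A.card ≤ 1 := Finset.card_le_one.2 fun a _ b _ => Subsingleton.elim a b
    interval_cases A.card <;> simp [hs0.ne']
  | succ k ih =>
    set a : ZMod p → ℝ := fun x => (firstCoordSection A x).card with ha
    obtain ⟨x₀, -, hx₀⟩ := Finset.exists_max_image Finset.univ a Finset.univ_nonempty
    have ha0 : ∀ x, 0 ≤ a x := fun x => Nat.cast_nonneg _
    set T : ℝ := ∑ x, a x ^ s with hT
    have hT0 : 0 ≤ T := Finset.sum_nonneg fun x _ => Real.rpow_nonneg (ha0 x) _
    have hA : (A.card : ℝ) = ∑ x, a x := by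
      rw [← sum_card_firstCoordSection A]; push_cast; rfl
    have hAT : (A.card : ℝ) ^ s ≤ T ^ s * (a x₀ ^ s) ^ (1 - s) := by
      rw [← Real.rpow_mul (ha0 x₀), mul_comm s, Real.rpow_mul (ha0 x₀),
        ← Real.mul_rpow hT0 (Real.rpow_nonneg (ha0 x₀) _), hA]
      refine Real.rpow_le_rpow (Finset.sum_nonneg fun x _ => ha0 x) ?_ hs0.le
      rw [hT, Finset.sum_mul]
      refine Finset.sum_le_sum fun x hx => ?_
      calc a x = a x ^ s * a x ^ (1 - s) := by
            rw [← Real.rpow_add_of_nonneg (ha0 x) hs0.le hs1'.le]; simp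
        _ ≤ _ := by
            exact mul_le_mul_of_nonneg_left
              (Real.rpow_le_rpow (ha0 x) (hx₀ x hx) hs1'.le) (Real.rpow_nonneg (ha0 x) _)
    have hamgm : L / r ^ s * (T ^ s * (a x₀ ^ s) ^ (1 - s)) ≤ l * T + a x₀ ^ s := by
      have := Real.geom_mean_le_arith_mean2_weighted hs0.le hs1'.le (div_nonneg hT0 hr.le)
        (Real.rpow_nonneg (ha0 x₀) s) (by ring)
      rw [Real.div_rpow hT0 hr.le] at this
      calc _ = L * (T ^ s / r ^ s * (a x₀ ^ s) ^ (1 - s)) := by ring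
        _ ≤ L * (s * (T / r) + (1 - s) * a x₀ ^ s) := by gcongr
        _ = _ := by rw [hs1, hs]; field_simp
    have hsec : ∀ x, (L / r ^ s) ^ k * max (a x ^ s) (a (x - 1) ^ s) ≤
        (firstCoordSection (A + zeroOneCube p (k + 1)) x).card := by
      intro x
      rw [mul_max_of_nonneg _ _ (pow_nonneg hC.le _)]
      refine max_le ((ih (firstCoordSection A x)).trans ?_)
        ((ih (firstCoordSection A (x - 1))).trans ?_)
      · have := firstCoordSection_add_subset A x 0 (by simp)
        rw [sub_zero] at this
        exact_mod_cast Finset.card_le_card this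
      · exact_mod_cast Finset.card_le_card (firstCoordSection_add_subset A x 1 (by simp))
    calc _ = (L / r ^ s) ^ k * (L / r ^ s * (A.card : ℝ) ^ s) := by ring
      _ ≤ (L / r ^ s) ^ k * (l * T + a x₀ ^ s) := by
          gcongr
          exact (mul_le_mul_of_nonneg_left hAT hC.le).trans hamgm
      _ ≤ (L / r ^ s) ^ k * ∑ x, max (a x ^ s) (a (x - 1) ^ s) := by
          gcongr
          rw [hl]
          exact mul_sum_add_le_sum_max (fun x => a x ^ s) x₀
      _ ≤ ∑ x, ((firstCoordSection (A + zeroOneCube p (k + 1)) x).card : ℝ) := by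
          rw [Finset.mul_sum]
          exact Finset.sum_le_sum fun x _ => hsec x
      _ = _ := by rw [← sum_card_firstCoordSection (A + zeroOneCube p (k + 1))]; push_cast; rfl

/-- Adding the discrete cube to a set of size at least `rᵏ` in `(ℤ/p)ᵏ` gives a set of size at
least `((1 - 1/p) r + 1)ᵏ`. The map `r ↦ (1 - 1/p) r + 1` has fixed point `p`, so iteration fills
the group exponentially fast. -/
theorem pow_le_card_add_cube {p : ℕ} (hp : 2 ≤ p) {r : ℝ} (hr : 0 < r) (k : ℕ)
    (A : Finset (Fin k → ZMod p)) (hA : r ^ k ≤ A.card) :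
    ((1 - 1 / (p : ℝ)) * r + 1) ^ k ≤ ((A + zeroOneCube p k).card : ℝ) := by
  have hl0 : 0 < 1 - 1 / (p : ℝ) := by
    have : (2 : ℝ) ≤ p := by exact_mod_cast hp
    rw [sub_pos, div_lt_one] <;> linarith
  refine le_trans ?_ (rpow_card_le_card_add_cube hp hr rfl rfl rfl k A)
  set s := (1 - 1 / (p : ℝ)) * r / ((1 - 1 / (p : ℝ)) * r + 1)
  have hs0 : 0 ≤ s := by positivity
  have h1 : (r ^ s) ^ k ≤ (A.card : ℝ) ^ s := by
    rw [Real.rpow_pow_comm hr.le]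
    exact Real.rpow_le_rpow (by positivity) hA hs0
  rw [div_pow]
  calc _ = ((1 - 1 / (p : ℝ)) * r + 1) ^ k / (r ^ s) ^ k * (r ^ s) ^ k := by field_simp
    _ ≤ _ := by gcongr

/-! ### Subset sums of several spanning families -/

/-- The sums `∑ e ∈ E, d e` over all subsets `E` of `S`. -/
def subsetSums {ι V : Type*} [AddCommGroup V] [DecidableEq V] (d : ι → V) (S : Finset ι) :
    Finset V :=
  S.powerset.image fun E => ∑ e ∈ E, d e

theorem mem_subsetSums {ι V : Type*} [AddCommGroup V] [DecidableEq V] {d : ι → V} {S : Finset ι}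
    {x : V} : x ∈ subsetSums d S ↔ ∃ E ⊆ S, ∑ e ∈ E, d e = x := by
  simp [subsetSums]

theorem subsetSums_add_subset {ι V : Type*} [AddCommGroup V] [DecidableEq V] [DecidableEq ι]
    {d : ι → V} {S T : Finset ι} (h : Disjoint S T) :
    subsetSums d S + subsetSums d T ⊆ subsetSums d (S ∪ T) := by
  intro x hx
  obtain ⟨_, hy, _, hz, rfl⟩ := Finset.mem_add.1 hx
  obtain ⟨E, hE, rfl⟩ := mem_subsetSums.1 hy
  obtain ⟨F, hF, rfl⟩ := mem_subsetSums.1 hz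
  exact mem_subsetSums.2 ⟨E ∪ F, Finset.union_subset_union hE hF,
    Finset.sum_union (Finset.disjoint_of_subset_left hE (Finset.disjoint_of_subset_right hF h))⟩

theorem exists_basis_mem_of_span_eq_top {K V : Type*} [Field K] [AddCommGroup V] [Module K V]
    [FiniteDimensional K V] {s : Set V} (hs : Submodule.span K s = ⊤) :
    ∃ b : Basis (Fin (finrank K V)) K V, ∀ i, b i ∈ s := by
  obtain ⟨t, hts, hspan, hind⟩ := exists_linearIndependent K s
  have htop : ⊤ ≤ Submodule.span K (Set.range ((↑) : t → V)) := by
    rw [Subtype.range_coe, hspan, hs]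
  let b := Basis.mk hind htop
  have : Fintype t := FiniteDimensional.fintypeBasisIndex b
  refine ⟨b.reindex (Fintype.equivFinOfCardEq (finrank_eq_card_basis b).symm), fun i => ?_⟩
  rw [Basis.reindex_apply, Basis.mk_apply]
  exact hts (Subtype.coe_prop _)

/-- The growth under a cube in coordinates: a spanning family contains a basis, whose subset sums
form a discrete cube. -/
theorem pow_le_card_add_subsetSums {p : ℕ} [Fact p.Prime] {V ι : Type*} [AddCommGroup V]
    [Module (ZMod p) V] [FiniteDimensional (ZMod p) V] [DecidableEq V] {d : ι → V} {S : Finset ι}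
    (hS : Submodule.span (ZMod p) (d '' (S : Set ι)) = ⊤) {r : ℝ} (hr : 0 < r) {A : Finset V}
    (hA : r ^ finrank (ZMod p) V ≤ A.card) :
    ((1 - 1 / (p : ℝ)) * r + 1) ^ finrank (ZMod p) V ≤ ((A + subsetSums d S).card : ℝ) := by
  classical
  obtain ⟨b, hb⟩ := exists_basis_mem_of_span_eq_top hS
  choose e heS he using hb
  have heinj : Function.Injective e := fun i j hij => b.injective (by rw [← he, ← he, hij])
  have hinj : Function.Injective b.equivFun := b.equivFun.injective
  have hA' : r ^ finrank (ZMod p) V ≤ ((A.image b.equivFun).card : ℝ) := by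
    rwa [Finset.card_image_of_injective _ hinj]
  refine (pow_le_card_add_cube (Fact.out : p.Prime).two_le hr _ _ hA').trans ?_
  rw [← Finset.card_image_of_injective (A + subsetSums d S) hinj]
  refine Nat.cast_le.2 (Finset.card_le_card fun x hx => ?_)
  obtain ⟨y, hy, c, hc, rfl⟩ := Finset.mem_add.1 hx
  obtain ⟨a, ha, rfl⟩ := Finset.mem_image.1 hy
  have hc' : ∀ i, c i = 0 ∨ c i = 1 := by
    simpa [zeroOneCube, Fintype.mem_piFinset] using hc
  refine Finset.mem_image.2 ⟨a + b.equivFun.symm c,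
    Finset.add_mem_add ha (mem_subsetSums.2
      ⟨(Finset.univ.filter fun i => c i = 1).image e, ?_, ?_⟩), by
      rw [map_add, LinearEquiv.apply_symm_apply]⟩
  · intro x hx
    obtain ⟨i, -, rfl⟩ := Finset.mem_image.1 hx
    exact heS i
  · rw [Finset.sum_image heinj.injOn, Basis.equivFun_symm_apply, Finset.sum_filter]
    refine Finset.sum_congr rfl fun i _ => ?_
    rcases hc' i with h | h <;> simp [h, he]

/-- The subset sums of `j` disjoint spanning families number at least `(p (1 - (1 - 1/p)^(j+1)))ᵏ`;
the base is the value after `j` steps of `r ↦ (1 - 1/p) r + 1` started at `r = 1`. -/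
theorem pow_le_card_subsetSums_biUnion {p : ℕ} [Fact p.Prime] {V ι κ : Type*} [AddCommGroup V]
    [Module (ZMod p) V] [FiniteDimensional (ZMod p) V] [DecidableEq V] [DecidableEq ι]
    {d : ι → V} {S : κ → Finset ι} (hdisj : Pairwise (Function.onFun Disjoint S))
    (hS : ∀ i, Submodule.span (ZMod p) (d '' (S i : Set ι)) = ⊤) (I : Finset κ) :
    ((p : ℝ) * (1 - (1 - 1 / (p : ℝ)) ^ (I.card + 1))) ^ finrank (ZMod p) V ≤
      ((subsetSums d (I.biUnion S)).card : ℝ) := by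
  classical
  have hp : (2 : ℝ) ≤ p := by exact_mod_cast (Fact.out : p.Prime).two_le
  have hl0 : 0 ≤ 1 - 1 / (p : ℝ) := by
    rw [sub_nonneg, div_le_one] <;> linarith
  have hl1 : 1 - 1 / (p : ℝ) < 1 := by
    have : 0 < 1 / (p : ℝ) := by positivity
    linarith
  induction I using Finset.induction_on with
  | empty =>
    have : (p : ℝ) * (1 - (1 - 1 / (p : ℝ))) = 1 := by field_simp; ring
    simp only [Finset.card_empty, zero_add, pow_one, this, one_pow, Finset.biUnion_empty]
    simp [subsetSums]
  | insert i I hi ih =>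
    have hpos : 0 < (p : ℝ) * (1 - (1 - 1 / (p : ℝ)) ^ (I.card + 1)) := by
      have : (1 - 1 / (p : ℝ)) ^ (I.card + 1) < 1 := pow_lt_one₀ hl0 hl1 (by omega)
      have : 0 < 1 - (1 - 1 / (p : ℝ)) ^ (I.card + 1) := by linarith
      positivity
    have hstep := pow_le_card_add_subsetSums (hS i) hpos ih
    have hval : (1 - 1 / (p : ℝ)) * ((p : ℝ) * (1 - (1 - 1 / (p : ℝ)) ^ (I.card + 1))) + 1 =
        (p : ℝ) * (1 - (1 - 1 / (p : ℝ)) ^ (I.card + 1 + 1)) := by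
      have : (p : ℝ) * (1 - 1 / (p : ℝ)) = p - 1 := by field_simp
      linear_combination (norm := ring_nf) this
    rw [Finset.card_insert_of_notMem hi, ← hval]
    refine hstep.trans (Nat.cast_le.2 (Finset.card_le_card ?_))
    rw [Finset.biUnion_insert, Finset.union_comm]
    refine subsetSums_add_subset ?_
    rw [Finset.disjoint_biUnion_left]
    exact fun i' hi' => hdisj fun h => hi (h ▸ hi')

/-- Additive bases: once `k (1 - 1/p)^(j+1) < 1/2`, the subset sums of `2j` disjoint spanning
families cover all of `V`. Each half of the families has subset sums filling more than half of the
group. -/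
theorem exists_subset_sum_eq {p : ℕ} [Fact p.Prime] {V ι κ : Type*} [AddCommGroup V]
    [Module (ZMod p) V] [FiniteDimensional (ZMod p) V] [DecidableEq ι]
    {d : ι → V} {S : κ → Finset ι} (hdisj : Pairwise (Function.onFun Disjoint S))
    (hS : ∀ i, Submodule.span (ZMod p) (d '' (S i : Set ι)) = ⊤) {I J : Finset κ}
    (hIJ : Disjoint I J) {j : ℕ} (hI : I.card = j) (hJ : J.card = j)
    (hj : finrank (ZMod p) V * (1 - 1 / (p : ℝ)) ^ (j + 1) < 1 / 2) (t : V) :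
    ∃ E, E ⊆ I.biUnion S ∪ J.biUnion S ∧ ∑ e ∈ E, d e = t := by
  classical
  have hp : (2 : ℝ) ≤ p := by exact_mod_cast (Fact.out : p.Prime).two_le
  have hfin : Finite V := Module.finite_of_finite (ZMod p)
  have : Fintype V := Fintype.ofFinite V
  have hcardV : (Fintype.card V : ℝ) = (p : ℝ) ^ finrank (ZMod p) V := by
    rw [Module.card_eq_pow_finrank (K := ZMod p), ZMod.card]; push_cast; rfl
  have hl0 : 0 ≤ 1 - 1 / (p : ℝ) := by
    rw [sub_nonneg, div_le_one] <;> linarith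
  have hl1 : 1 - 1 / (p : ℝ) ≤ 1 := by
    have : 0 < 1 / (p : ℝ) := by positivity
    linarith
  have hhalf : ∀ I : Finset κ, I.card = j →
      (Fintype.card V : ℝ) / 2 < (subsetSums d (I.biUnion S)).card := by
    intro I hI
    have hcard := pow_le_card_subsetSums_biUnion hdisj hS I
    rw [hI, mul_pow] at hcard
    refine lt_of_lt_of_le ?_ hcard
    have hbern := one_add_mul_le_pow (a := -(1 - 1 / (p : ℝ)) ^ (j + 1))
      (by linarith [pow_le_one₀ (n := j + 1) hl0 hl1]) (finrank (ZMod p) V)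
    have hlt : 1 / 2 < (1 - (1 - 1 / (p : ℝ)) ^ (j + 1)) ^ finrank (ZMod p) V := by
      rw [← sub_eq_add_neg] at hbern
      linarith
    rw [hcardV, div_eq_mul_one_div]
    gcongr
  -- Two sets filling more than half of the group have sumset everything.
  set A := subsetSums d (I.biUnion S)
  set B := (subsetSums d (J.biUnion S)).image fun x => t - x
  have hBcard : B.card = (subsetSums d (J.biUnion S)).card :=
    Finset.card_image_of_injective _ (sub_right_injective)
  have hAB : ¬ Disjoint A B := by
    intro h
    have h1 := Finset.card_le_univ (A ∪ B)
    rw [Finset.card_union_of_disjoint h, hBcard] at h1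
    have h2 := hhalf I hI
    have h3 := hhalf J hJ
    have h4 : ((A.card + (subsetSums d (J.biUnion S)).card : ℕ) : ℝ) ≤ Fintype.card V := by
      exact_mod_cast h1
    push_cast at h4
    linarith
  obtain ⟨a, haA, haB⟩ := Finset.not_disjoint_iff.1 hAB
  obtain ⟨b, hb, rfl⟩ := Finset.mem_image.1 haB
  have hmem := subsetSums_add_subset (d := d) (S := I.biUnion S) (T := J.biUnion S)
    (by
      rw [Finset.disjoint_biUnion_left]
      intro i hi
      rw [Finset.disjoint_biUnion_right]
      intro i' hi'
      exact hdisj fun h => Finset.disjoint_left.1 hIJ hi (h ▸ hi'))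
    (Finset.add_mem_add haA hb)
  simpa using mem_subsetSums.1 hmem

end

/-! ### Matchings with spanning labels -/

/-- Among the members of a linearly independent family, the ones needed to express `x`: if `x` lies
in the span of `A` but not in the span of `B ⊆ A`, then deleting some `f ∈ A \ B` from the whole
family leaves `x` outside the span. -/
theorem LinearIndepOn.exists_notMem_span_erase {K V ι : Type*} [DivisionRing K] [AddCommGroup V]
    [Module K V] [DecidableEq ι] {v : ι → V} {G A B : Finset ι}
    (hG : LinearIndepOn K v (G : Set ι)) (hAG : A ⊆ G) (hBA : B ⊆ A) {x : V}
    (hxA : x ∈ Submodule.span K (v '' (A : Set ι)))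
    (hxB : x ∉ Submodule.span K (v '' (B : Set ι))) :
    ∃ f ∈ A, f ∉ B ∧ x ∉ Submodule.span K (v '' (G.erase f : Set ι)) := by
  induction A using Finset.strongInduction with
  | H A ih =>
    obtain ⟨f, hfA, hfB⟩ : ∃ f ∈ A, f ∉ B := by
      by_contra! h
      rw [Finset.Subset.antisymm h hBA] at hxA
      exact hxB hxA
    by_cases hx : x ∈ Submodule.span K (v '' (A.erase f : Set ι))
    · obtain ⟨g, hgA, hg⟩ := ih (A.erase f) (Finset.erase_ssubset hfA)
        ((Finset.erase_subset _ _).trans hAG) (Finset.subset_erase.2 ⟨hBA, hfB⟩) hx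
      exact ⟨g, Finset.mem_of_mem_erase hgA, hg⟩
    · refine ⟨f, hfA, hfB, fun hxG => ?_⟩
      have hins : v '' (A : Set ι) = insert (v f) (v '' (A.erase f : Set ι)) := by
        rw [← Set.image_insert_eq, ← Finset.coe_insert, Finset.insert_erase hfA]
      rw [hins] at hxA
      have hf := mem_span_insert_exchange hxA hx
      have hfG : v f ∈ Submodule.span K (v '' (G.erase f : Set ι)) := by
        refine Submodule.span_le.2 ?_ hf
        rintro y (rfl | hy)
        · exact hxG
        · exact Submodule.subset_span
            (Set.image_mono (by exact_mod_cast Finset.erase_subset_erase f hAG) hy)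
      have hGf : LinearIndepOn K v (insert f (G.erase f : Set ι)) := by
        rw [← Finset.coe_insert, Finset.insert_erase (hAG hfA)]; exact hG
      exact ((linearIndepOn_insert (by simp)).1 hGf).2 hfG

section

variable {K V E X : Type*} [Field K] [AddCommGroup V] [Module K V]
  (vert : E → Finset X) (val : E → V)

/-- A matching of hyperedges (`vert e` is the vertex set of `e`) whose labels are linearly
independent. -/
structure IsIndepMatching (K : Type*) {V E X : Type*} [Field K] [AddCommGroup V] [Module K V]
    (vert : E → Finset X) (val : E → V) (G : Finset E) : Prop where
  pairwise_disjoint : (G : Set E).PairwiseDisjoint vert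
  linearIndepOn : LinearIndepOn K val (G : Set E)

open Classical in
/-- The members of `G` that avoid the vertex set `Y`. -/
noncomputable def avoiding {E X : Type*} (vert : E → Finset X) (G : Finset E) (Y : Finset X) :
    Finset E :=
  G.filter fun g => Disjoint (vert g) Y

open Classical in
/-- The members of `G` that meet the vertex set `Y`. -/
noncomputable def meeting {E X : Type*} (vert : E → Finset X) (G : Finset E) (Y : Finset X) :
    Finset E :=
  G.filter fun g => ¬ Disjoint (vert g) Y

variable {vert val}

theorem mem_avoiding {G : Finset E} {Y : Finset X} {g : E} :
    g ∈ avoiding vert G Y ↔ g ∈ G ∧ Disjoint (vert g) Y := by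
  simp [avoiding]

theorem mem_meeting {G : Finset E} {Y : Finset X} {g : E} :
    g ∈ meeting vert G Y ↔ g ∈ G ∧ ¬ Disjoint (vert g) Y := by
  simp [meeting]

theorem card_avoiding_add_card_meeting (G : Finset E) (Y : Finset X) :
    (avoiding vert G Y).card + (meeting vert G Y).card = G.card := by
  classical
  exact Finset.card_filter_add_card_filter_not _

theorem meeting_exchange [DecidableEq E] {G : Finset E} {Y : Finset X} {f e : E}
    (hf : Disjoint (vert f) Y) (he : Disjoint (vert e) Y) :
    meeting vert (insert e (G.erase f)) Y = meeting vert G Y := by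
  ext g
  simp only [mem_meeting, Finset.mem_insert, Finset.mem_erase]
  constructor
  · rintro ⟨rfl | ⟨-, h⟩, h'⟩
    · exact absurd he h'
    · exact ⟨h, h'⟩
  · rintro ⟨h, h'⟩
    exact ⟨Or.inr ⟨fun hgf => h' (hgf ▸ hf), h⟩, h'⟩

theorem IsIndepMatching.exchange [DecidableEq E] {G : Finset E} (hG : IsIndepMatching K vert val G)
    {f e : E} (he : ∀ g ∈ G, Disjoint (vert e) (vert g))
    (hspan : val e ∉ Submodule.span K (val '' (G.erase f : Set E))) :
    IsIndepMatching K vert val (insert e (G.erase f)) := by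
  have hsub : (G.erase f : Set E) ⊆ G := by exact_mod_cast Finset.erase_subset f G
  constructor
  · rw [Finset.coe_insert]
    exact (hG.1.subset hsub).insert fun g hg _ => he g (hsub hg)
  · rw [Finset.coe_insert]
    exact (hG.2.mono hsub).insert hspan

theorem span_avoiding_exchange_le [DecidableEq E] {G : Finset E} {Y : Finset X} {f e : E}
    (hspan : val e ∈ Submodule.span K (val '' (avoiding vert G Y : Set E))) :
    Submodule.span K (val '' (avoiding vert (insert e (G.erase f)) Y : Set E)) ≤
      Submodule.span K (val '' (avoiding vert G Y : Set E)) := by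
  rw [Submodule.span_le]
  rintro _ ⟨g, hg, rfl⟩
  obtain ⟨hg, hgY⟩ := mem_avoiding.1 (Finset.mem_coe.1 hg)
  rcases Finset.mem_insert.1 hg with rfl | hg
  · exact hspan
  · exact Submodule.subset_span
      ⟨g, Finset.mem_coe.2 (mem_avoiding.2 ⟨Finset.mem_of_mem_erase hg, hgY⟩), rfl⟩

/-- The alternating-tree argument behind Haxell's theorem, for labels in a vector space. Suppose the
largest independent matchings have only `t < dim V` members. The nodes of the tree built so far
cover the vertex set `Y`, and `P` collects the maximum matchings compatible with the tree: all of
them have exactly `N` members meeting `Y`, `P` is stable under exchanges that take place away from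
`Y`, and (`hmax`) no edge disjoint from `Y` and from the matching enlarges the span of the members
that avoid `Y`. As `Y` and the members meeting it occupy at most `2 r N` vertices, the hypothesis
`hE` provides an edge `e`, disjoint from them, with label outside the span of the remaining `t - N`
members. Choosing `e` and the matching so that `e` is blocked by as few members as possible, the
tree can be extended by `e`, and `N` grows. Since `N ≤ t`, this cannot go on forever. -/
theorem false_of_exchange_closed [FiniteDimensional K V] [DecidableEq E] [DecidableEq X]
    {r : ℕ} (hr : ∀ e, (vert e).card ≤ r)
    (hE : ∀ (U : Submodule K V) (T : Finset X), U < ⊤ → T.card ≤ 2 * r * finrank K (V ⧸ U) →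
      ∃ e, Disjoint (vert e) T ∧ val e ∉ U)
    {t : ℕ} (ht : t < finrank K V) (P : Finset E → Prop) (Y : Finset X) (N : ℕ)
    (hne : ∃ G, P G) (hY : Y.card ≤ r * N)
    (hP : ∀ G, P G → IsIndepMatching K vert val G ∧ G.card = t ∧ (meeting vert G Y).card = N)
    (hex : ∀ G f e, P G → f ∈ G → e ∉ G → Disjoint (vert f) Y → Disjoint (vert e) Y →
      val e ∈ Submodule.span K (val '' (avoiding vert G Y : Set E)) →
      IsIndepMatching K vert val (insert e (G.erase f)) → P (insert e (G.erase f)))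
    (hmax : ∀ G e, P G → (∀ g ∈ G, Disjoint (vert e) (vert g)) → Disjoint (vert e) Y →
      val e ∈ Submodule.span K (val '' (avoiding vert G Y : Set E))) :
    False := by
  induction hd : t - N using Nat.strong_induction_on generalizing P Y N with
  | _ d ih =>
  classical
  subst hd
  let Cand : Finset E → E → Prop := fun G e => P G ∧ Disjoint (vert e) Y ∧
    (∀ g ∈ meeting vert G Y, Disjoint (vert e) (vert g)) ∧
    val e ∉ Submodule.span K (val '' (avoiding vert G Y : Set E))
  have hcand : ∃ n G e, Cand G e ∧ (meeting vert G (Y ∪ vert e)).card = n := by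
    obtain ⟨G, hG⟩ := hne
    obtain ⟨-, hcard, hN⟩ := hP G hG
    set U := Submodule.span K (val '' (avoiding vert G Y : Set E)) with hU
    have hUrank : finrank K U ≤ (avoiding vert G Y).card := by
      rw [hU, ← Finset.coe_image]
      exact (finrank_span_finset_le_card _).trans Finset.card_image_le
    have hsum := card_avoiding_add_card_meeting (vert := vert) G Y
    have hquot := U.finrank_quotient_add_finrank
    have hUlt : U < ⊤ := Submodule.lt_top_of_finrank_lt_finrank (by omega)
    have hbi : ((meeting vert G Y).biUnion vert).card ≤ N * r := by
      rw [← hN]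
      exact Finset.card_biUnion_le_card_mul _ _ _ fun e _ => hr e
    obtain ⟨e, heT, heU⟩ := hE U (Y ∪ (meeting vert G Y).biUnion vert) hUlt <|
      calc (Y ∪ (meeting vert G Y).biUnion vert).card ≤ r * N + N * r :=
            (Finset.card_union_le _ _).trans (add_le_add hY hbi)
        _ = 2 * r * N := by ring
        _ ≤ 2 * r * finrank K (V ⧸ U) := Nat.mul_le_mul_left _ (by omega)
    rw [Finset.disjoint_union_right, Finset.disjoint_biUnion_right] at heT
    exact ⟨_, G, e, ⟨hG, heT.1, heT.2, heU⟩, rfl⟩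
  set N' := Nat.find hcand with hN'
  obtain ⟨G₀, e, ⟨hG₀, heY, heM, heU⟩, hcard₀⟩ := Nat.find_spec hcand
  rw [← hN'] at hcard₀
  have hmin : ∀ G e, Cand G e → N' ≤ (meeting vert G (Y ∪ vert e)).card :=
    fun G e h => Nat.find_min' hcand ⟨G, e, h, rfl⟩
  have hsubM : meeting vert G₀ Y ⊆ meeting vert G₀ (Y ∪ vert e) := by
    intro g hg
    rw [mem_meeting, Finset.disjoint_union_right] at *
    exact ⟨hg.1, fun h => hg.2 h.1⟩
  have hNN' : N < N' := by
    rw [← hcard₀, ← (hP G₀ hG₀).2.2]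
    refine Finset.card_lt_card (hsubM.ssubset_of_ne fun heq => heU (hmax G₀ e hG₀ ?_ heY))
    intro g hg
    by_contra hdisj
    have hgM : g ∈ meeting vert G₀ (Y ∪ vert e) := by
      rw [mem_meeting, Finset.disjoint_union_right]
      exact ⟨hg, fun h => hdisj h.2.symm⟩
    exact hdisj (heM g (heq ▸ hgM))
  have hN't : N' ≤ t := by
    rw [← hcard₀, ← (hP G₀ hG₀).2.1]
    exact Finset.card_le_card fun g hg => (mem_meeting.1 hg).1
  have hsubA : ∀ G : Finset E, avoiding vert G (Y ∪ vert e) ⊆ avoiding vert G Y := by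
    intro G g hg
    rw [mem_avoiding, Finset.disjoint_union_right] at *
    exact ⟨hg.1, hg.2.1⟩
  have hmono : ∀ G : Finset E,
      Submodule.span K (val '' (avoiding vert G (Y ∪ vert e) : Set E)) ≤
        Submodule.span K (val '' (avoiding vert G Y : Set E)) :=
    fun G => Submodule.span_mono (Set.image_mono (by exact_mod_cast hsubA G))
  -- An exchange away from `Y` keeps `e` a candidate, as the span of the members avoiding `Y` can
  -- only shrink and the members meeting `Y` stay the same.
  have hcandex : ∀ G f e', Cand G e → f ∈ G → e' ∉ G → Disjoint (vert f) Y →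
      Disjoint (vert e') Y → val e' ∈ Submodule.span K (val '' (avoiding vert G Y : Set E)) →
      IsIndepMatching K vert val (insert e' (G.erase f)) → Cand (insert e' (G.erase f)) e := by
    rintro G f e' ⟨hG, -, hM, hU⟩ hf he' hfY he'Y hspan hind
    refine ⟨hex G f e' hG hf he' hfY he'Y hspan hind, heY, ?_, fun h => hU ?_⟩
    · rw [meeting_exchange hfY he'Y]; exact hM
    · exact span_avoiding_exchange_le hspan h
  refine ih (t - N') (by omega)
    (fun G => Cand G e ∧ (meeting vert G (Y ∪ vert e)).card = N') (Y ∪ vert e) N'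
    ⟨G₀, ⟨hG₀, heY, heM, heU⟩, hcard₀⟩ ?_ ?_ ?_ ?_ rfl
  · calc (Y ∪ vert e).card ≤ r * N + r :=
          (Finset.card_union_le _ _).trans (add_le_add hY (hr e))
      _ = r * (N + 1) := by ring
      _ ≤ r * N' := Nat.mul_le_mul_left _ hNN'
  · rintro G ⟨hG, hGN⟩
    exact ⟨(hP G hG.1).1, (hP G hG.1).2.1, hGN⟩
  · rintro G f e' ⟨hG, hGN⟩ hf he' hfY he'Y hspan hind
    refine ⟨hcandex G f e' hG hf he' (Finset.disjoint_union_right.1 hfY).1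
      (Finset.disjoint_union_right.1 he'Y).1 (hmono G hspan) hind, ?_⟩
    rw [meeting_exchange hfY he'Y]; exact hGN
  · -- An edge `e'` violating the maximality for `Y ∪ vert e` could replace a member `f` that
    -- blocks `e`, against the minimal choice of the number of members meeting `Y ∪ vert e`.
    rintro G e' ⟨hG, hGN⟩ he'G he'Y
    by_contra hspan
    have he'Y₀ := (Finset.disjoint_union_right.1 he'Y).1
    have he'mem : e' ∉ G := fun h =>
      hspan (Submodule.subset_span ⟨e', Finset.mem_coe.2 (mem_avoiding.2 ⟨h, he'Y⟩), rfl⟩)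
    have hspan₀ := hmax G e' hG.1 he'G he'Y₀
    have hGind := (hP G hG.1).1
    obtain ⟨f, hfA, hfB, hfspan⟩ := hGind.linearIndepOn.exists_notMem_span_erase
      (fun g hg => (mem_avoiding.1 hg).1) (hsubA G) hspan₀ hspan
    obtain ⟨hfG, hfY⟩ := mem_avoiding.1 hfA
    have hcand' := hcandex G f e' hG hfG he'mem hfY he'Y₀ hspan₀ (hGind.exchange he'G hfspan)
    have hlt : (meeting vert (insert e' (G.erase f)) (Y ∪ vert e)).card <
        (meeting vert G (Y ∪ vert e)).card := by
      refine Finset.card_lt_card (Finset.ssubset_iff_of_subset ?_ |>.2 ⟨f, ?_, ?_⟩)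
      · intro g hg
        rw [mem_meeting, Finset.mem_insert, Finset.mem_erase] at hg
        rcases hg with ⟨rfl | hg, hgY⟩
        · exact absurd he'Y hgY
        · exact mem_meeting.2 ⟨hg.2, hgY⟩
      · exact mem_meeting.2 ⟨hfG, fun h => hfB (mem_avoiding.2 ⟨hfG, h⟩)⟩
      · rw [mem_meeting, Finset.mem_insert, Finset.mem_erase]
        rintro ⟨rfl | h, -⟩
        · exact he'mem hfG
        · exact h.1 rfl
    have := hmin _ _ hcand'
    omega

/-- A Haxell-type theorem for hyperedges with vector labels: if for every proper subspace `U` the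
edges with labels outside `U` cannot be covered by `2 r · codim U` vertices, then some matching has
labels spanning `V`. -/
theorem exists_pairwiseDisjoint_span_eq_top [FiniteDimensional K V] {r : ℕ}
    (hr : ∀ e, (vert e).card ≤ r)
    (hE : ∀ (U : Submodule K V) (T : Finset X), U < ⊤ → T.card ≤ 2 * r * finrank K (V ⧸ U) →
      ∃ e, Disjoint (vert e) T ∧ val e ∉ U) :
    ∃ G : Finset E, (G : Set E).PairwiseDisjoint vert ∧
      Submodule.span K (val '' (G : Set E)) = ⊤ := by
  classical
  have hle : ∀ G, IsIndepMatching K vert val G → G.card ≤ finrank K V := by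
    intro G hG
    have := LinearIndependent.fintype_card_le_finrank (R := K) hG.linearIndepOn
    simpa using this
  have hex : ∃ n, ∃ G, IsIndepMatching K vert val G ∧ G.card = n :=
    ⟨0, ∅, ⟨by simp, by simp⟩, rfl⟩
  obtain ⟨n₀, hn₀⟩ := hex
  have hbdd : ∀ n, (∃ G, IsIndepMatching K vert val G ∧ G.card = n) → n ≤ finrank K V := by
    rintro n ⟨G, hG, rfl⟩; exact hle G hG
  obtain ⟨G₀, hG₀, hcard₀⟩ := Nat.findGreatest_spec
    (P := fun n => ∃ G, IsIndepMatching K vert val G ∧ G.card = n) (hbdd n₀ hn₀) hn₀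
  set t := Nat.findGreatest (fun n => ∃ G, IsIndepMatching K vert val G ∧ G.card = n)
    (finrank K V) with ht
  have hmax : ∀ G, IsIndepMatching K vert val G → G.card ≤ t := fun G hG =>
    Nat.le_findGreatest (hle G hG) ⟨G, hG, rfl⟩
  refine ⟨G₀, hG₀.pairwise_disjoint, ?_⟩
  by_contra hspan
  have hlt : t < finrank K V := by
    refine lt_of_le_of_ne (hcard₀ ▸ hle G₀ hG₀) fun heq => hspan ?_
    have := LinearIndependent.span_eq_top_of_card_eq_finrank' (K := K) hG₀.linearIndepOn
      (by simpa using hcard₀.trans heq)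
    rwa [← Function.comp_def, Set.range_comp, Subtype.range_coe_subtype] at this
  refine false_of_exchange_closed hr hE hlt
    (fun G => IsIndepMatching K vert val G ∧ G.card = t) ∅ 0 ⟨G₀, hG₀, hcard₀⟩ (by simp)
    ?_ ?_ ?_
  · rintro G ⟨hG, hGt⟩
    refine ⟨hG, hGt, ?_⟩
    simp [meeting]
  · rintro G f e ⟨hG, hGt⟩ hf he - - - hind
    refine ⟨hind, ?_⟩
    rw [Finset.card_insert_of_notMem (fun h => he (Finset.mem_of_mem_erase h)),
      Finset.card_erase_add_one hf, hGt]
  · rintro G e ⟨hG, hGt⟩ heG -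
    by_contra hspan
    have hav : avoiding vert G ∅ = G := by ext; simp [mem_avoiding]
    rw [hav] at hspan
    have heG' : e ∉ G := fun h => hspan (Submodule.subset_span ⟨e, h, rfl⟩)
    have hins : IsIndepMatching K vert val (insert e G) := by
      constructor
      · rw [Finset.coe_insert]
        exact hG.1.insert fun g hg _ => heG g hg
      · rw [Finset.coe_insert]
        exact hG.2.insert hspan
    have := hmax _ hins
    rw [Finset.card_insert_of_notMem heG'] at this
    omega

end

/-- Subspaces of `Vᵐ`: the codimension of `U` is at most the sum of the codimensions of its
intersections with the `m` coordinate copies of `V`. -/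
theorem finrank_quotient_le_sum_comap_single {K V : Type*} [Field K] [AddCommGroup V] [Module K V]
    [FiniteDimensional K V] {m : ℕ} (U : Submodule K (Fin m → V)) :
    finrank K ((Fin m → V) ⧸ U) ≤
      ∑ i, finrank K (V ⧸ U.comap (LinearMap.single K (fun _ : Fin m => V) i)) := by
  rw [← finrank_pi_fintype K]
  refine LinearMap.finrank_le_finrank_of_surjective
    (f := Submodule.piQuotientLift (fun i => U.comap (LinearMap.single K (fun _ : Fin m => V) i))
      U (LinearMap.single K (fun _ : Fin m => V)) fun i => le_rfl) fun y => ?_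
  obtain ⟨x, rfl⟩ := Submodule.Quotient.mk_surjective _ y
  refine ⟨fun i => Submodule.Quotient.mk (x i), ?_⟩
  rw [Submodule.piQuotientLift_mk, LinearMap.lsum_single, LinearMap.id_apply]

/-- The version with `m` spanning classes, from the version with one class applied to `Vᵐ`: the
edge `e` in class `i` gets the label `val e` placed in the `i`-th coordinate. -/
theorem exists_disjoint_spanning_classes {K V E X : Type*} [Field K] [AddCommGroup V] [Module K V]
    [FiniteDimensional K V] {vert : E → Finset X} {val : E → V} {r : ℕ}
    (hr : ∀ e, (vert e).card ≤ r) (m : ℕ)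
    (hE : ∀ (U : Submodule K V) (T : Finset X), U < ⊤ → T.card ≤ 2 * r * m * finrank K (V ⧸ U) →
      ∃ e, Disjoint (vert e) T ∧ val e ∉ U) :
    ∃ G : Finset (E × Fin m), (G : Set (E × Fin m)).PairwiseDisjoint (fun g => vert g.1) ∧
      ∀ i, Submodule.span K (val '' {e | (e, i) ∈ G}) = ⊤ := by
  classical
  obtain ⟨G, hG, hspan⟩ := exists_pairwiseDisjoint_span_eq_top (K := K) (E := E × Fin m)
    (vert := fun g => vert g.1) (val := fun g => Pi.single g.2 (val g.1))
    (fun g => hr g.1) (V := Fin m → V) (fun U T hU hT => by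
      by_contra! hno
      set W := fun i => U.comap (LinearMap.single K (fun _ : Fin m => V) i) with hW
      have hsum := finrank_quotient_le_sum_comap_single U
      have hUpos : 0 < finrank K ((Fin m → V) ⧸ U) := by
        have h1 := U.finrank_quotient_add_finrank
        have h2 := Submodule.finrank_lt hU.ne
        omega
      have hm : (Finset.univ : Finset (Fin m)).Nonempty := by
        by_contra h
        rw [Finset.not_nonempty_iff_eq_empty] at h
        rw [h, Finset.sum_empty] at hsum
        omega
      obtain ⟨i, -, hi⟩ := Finset.exists_max_image Finset.univ
        (fun i => finrank K (V ⧸ W i)) hm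
      have hle : finrank K ((Fin m → V) ⧸ U) ≤ m * finrank K (V ⧸ W i) := by
        refine hsum.trans ((Finset.sum_le_card_nsmul _ _ _ hi).trans ?_)
        simp
      have hWi : W i < ⊤ := by
        refine lt_top_iff_ne_top.2 fun htop => ?_
        have h1 := (W i).finrank_quotient_add_finrank
        rw [htop, finrank_top] at h1
        have h0 : finrank K (V ⧸ W i) = 0 := by rw [htop]; omega
        rw [h0] at hle
        omega
      obtain ⟨e, heT, heW⟩ := hE (W i) T hWi <| hT.trans <| by
        rw [mul_assoc (2 * r)]
        exact Nat.mul_le_mul_left _ hle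
      exact heW (hno (e, i) heT))
  refine ⟨G, hG, fun i => ?_⟩
  have hmap : (⊤ : Submodule K V) = (Submodule.span K
      ((fun g : E × Fin m => (Pi.single g.2 (val g.1) : Fin m → V)) '' (G : Set (E × Fin m)))).map
      (LinearMap.proj i) := by
    rw [hspan, Submodule.map_top, LinearMap.range_eq_top.2 (LinearMap.proj_surjective i)]
  rw [eq_top_iff, hmap, Submodule.map_span, Submodule.span_le]
  rintro _ ⟨_, ⟨⟨e, j⟩, hg, rfl⟩, rfl⟩
  by_cases hij : j = i
  · subst hij
    simpa using Submodule.subset_span (Set.mem_image_of_mem val (Set.mem_ofPred.2 hg))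
  · simp [Pi.single_eq_of_ne (Ne.symm hij)]

/-! ### Detours and cycles -/

section

variable {X A : Type*} [AddCommGroup A]

/-- The weight of the walk that starts at `a` and then visits the vertices of the list in order. -/
def walkWeight (w : X → X → A) : X → List X → A
  | _, [] => 0
  | a, b :: l => w a b + walkWeight w b l

theorem cycleWeight_cons (w : X → X → A) (a : X) (l : List X) :
    cycleWeight w (a :: l) = walkWeight w a (l ++ [a]) := by
  have key : ∀ (l : List X) (a z : X),
      (List.zipWith w (a :: l) (l ++ [z])).sum = walkWeight w a (l ++ [z]) := by
    intro l
    induction l with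
    | nil => intro a z; simp [walkWeight]
    | cons b l ih => intro a z; simp only [List.cons_append, List.zipWith_cons_cons, List.sum_cons,
        walkWeight, ← ih]
  rw [cycleWeight, List.rotate_cons_succ, List.rotate_zero, key]

/-- An ordered triple `(u, x, v)` of distinct vertices outside `S`, thought of as the arc `u → v`
together with the detour `u → x → v`. -/
structure Detour {X : Type*} (S : Finset X) where
  /-- The initial vertex. -/
  src : X
  /-- The vertex that may be inserted. -/
  mid : X
  /-- The final vertex. -/
  tgt : X
  src_ne_mid : src ≠ mid
  mid_ne_tgt : mid ≠ tgt
  src_ne_tgt : src ≠ tgt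
  src_notMem : src ∉ S
  mid_notMem : mid ∉ S
  tgt_notMem : tgt ∉ S

/-- The vertex set of a detour. -/
def Detour.support [DecidableEq X] {S : Finset X} (g : Detour S) : Finset X :=
  {g.src, g.mid, g.tgt}

/-- The weight gained by taking the detour instead of the arc. -/
def Detour.gain {S : Finset X} (w : X → X → A) (g : Detour S) : A :=
  w g.src g.mid + w g.mid g.tgt - w g.src g.tgt

/-- The vertex list of the arc (`false`) or of the detour (`true`). -/
def Detour.route {S : Finset X} (g : Detour S) : Bool → List X
  | false => [g.src, g.tgt]
  | true => [g.src, g.mid, g.tgt]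

/-- Switching from arcs to detours changes the weight of a walk by the gains of the detours
taken. -/
theorem walkWeight_flatMap_route {S : Finset X} {ι : Type*} (w : X → X → A) (g : ι → Detour S)
    (ε : ι → Bool) (L : List ι) (a : X) (l : List X) :
    walkWeight w a (L.flatMap (fun i => (g i).route (ε i)) ++ l) =
      walkWeight w a (L.flatMap (fun i => (g i).route false) ++ l) +
        (L.map fun i => if ε i then (g i).gain w else 0).sum := by
  induction L generalizing a with
  | nil => simp
  | cons i L ih =>
    have hfalse : (g i).route false = [(g i).src, (g i).tgt] := rfl
    have htrue : (g i).route true = [(g i).src, (g i).mid, (g i).tgt] := rfl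
    rw [List.flatMap_cons, List.flatMap_cons, List.map_cons, List.sum_cons]
    cases ε i
    · simp only [hfalse, List.cons_append, List.nil_append, walkWeight, ih, Bool.false_eq_true,
        if_false, zero_add, add_assoc]
    · simp only [hfalse, htrue, List.cons_append, List.nil_append, walkWeight, ih, if_true,
        Detour.gain]
      abel

theorem cycleWeight_flatMap_route {S : Finset X} {ι : Type*} (w : X → X → A) (g : ι → Detour S)
    (ε : ι → Bool) (L : List ι) :
    cycleWeight w (L.flatMap fun i => (g i).route (ε i)) =
      cycleWeight w (L.flatMap fun i => (g i).route false) +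
        (L.map fun i => if ε i then (g i).gain w else 0).sum := by
  cases L with
  | nil => simp [cycleWeight]
  | cons i L =>
    have hhead : ∀ δ : ι → Bool, ∃ l,
        (i :: L).flatMap (fun i => (g i).route (δ i)) = (g i).src :: l := by
      intro δ
      cases h : δ i <;> simp [Detour.route, h]
    obtain ⟨l, hl⟩ := hhead ε
    obtain ⟨l', hl'⟩ := hhead fun _ => false
    have := walkWeight_flatMap_route w g ε (i :: L) (g i).src [(g i).src]
    rw [hl, hl'] at this ⊢
    simp only [List.cons_append, walkWeight, add_assoc, add_right_inj] at this
    rw [cycleWeight_cons, cycleWeight_cons, this]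

end

section

variable {X K V : Type*} [Field K] [AddCommGroup V] [Module K V]

/-- If no detour outside `S` has a gain outside `U`, then modulo `U` the weights outside `S` are the
differences of a potential. The third vertex provided by `hX` is what forces
`w u v + w v u ∈ U`. -/
theorem exists_potential [Fintype X] [DecidableEq X] {S : Finset X} {U : Submodule K V}
    {w : X → X → V}
    (hX : S.card + 3 ≤ Fintype.card X) (hU : ∀ g : Detour S, g.gain w ∈ U) :
    ∃ φ : X → V, ∀ u v, u ∉ S → v ∉ S → u ≠ v → w u v - (φ v - φ u) ∈ U := by
  have hfresh : ∀ T : Finset X, T.card < 3 → ∃ x, x ∉ S ∧ x ∉ T := by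
    intro T hT
    obtain ⟨x, hx⟩ : ∃ x, x ∉ S ∪ T := by
      by_contra! h
      have h1 : Finset.univ ⊆ S ∪ T := fun x _ => h x
      have h2 := (Finset.card_le_card h1).trans (Finset.card_union_le _ _)
      rw [Finset.card_univ] at h2
      omega
    exact ⟨x, by simpa [not_or] using hx⟩
  obtain ⟨z, hz, -⟩ := hfresh ∅ (by simp)
  refine ⟨fun v => if v = z then 0 else w z v, fun u v hu hv huv => ?_⟩
  by_cases huz : u = z
  · subst huz
    simp [huv.symm]
  by_cases hvz : v = z
  · subst hvz
    obtain ⟨x, hx, hxT⟩ := hfresh {u, v} ((Finset.card_le_two).trans_lt (by omega))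
    simp only [Finset.mem_insert, Finset.mem_singleton, not_or] at hxT
    have h1 := hU ⟨u, v, x, huv, Ne.symm hxT.2, Ne.symm hxT.1, hu, hv, hx⟩
    have h2 := hU ⟨v, u, x, huv.symm, Ne.symm hxT.1, Ne.symm hxT.2, hv, hu, hx⟩
    convert U.add_mem h1 h2 using 1
    simp only [Detour.gain, if_true, if_neg huv]
    abel
  · have h1 := hU ⟨z, u, v, Ne.symm huz, huv, Ne.symm hvz, hz, hu, hv⟩
    convert h1 using 1
    simp only [Detour.gain, if_neg huz, if_neg hvz]
    abel

/-- Potential differences telescope around a cycle. -/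
theorem cycleWeight_mem_of_potential {S : Finset X} {U : Submodule K V} {w : X → X → V}
    {φ : X → V} (hφ : ∀ u v, u ∉ S → v ∉ S → u ≠ v → w u v - (φ v - φ u) ∈ U) {c : List X}
    (hc : 2 ≤ c.length) (hnd : c.Nodup) (hS : ∀ x ∈ c, x ∉ S) : cycleWeight w c ∈ U := by
  have key : ∀ (l : List X) (a z : X), (a :: l).Nodup → z ∉ l → (l ≠ [] ∨ a ≠ z) →
      (∀ x ∈ a :: l, x ∉ S) → z ∉ S → walkWeight w a (l ++ [z]) - (φ z - φ a) ∈ U := by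
    intro l
    induction l with
    | nil =>
      intro a z _ _ hne haS hzS
      simpa [walkWeight] using hφ a z (haS a (by simp)) hzS (by simpa using hne)
    | cons b l ih =>
      intro a z hnd hz _ haS hzS
      rw [List.nodup_cons] at hnd
      simp only [List.mem_cons, not_or] at hz hnd
      have h1 := hφ a b (haS a (by simp)) (haS b (by simp)) hnd.1.1
      have h2 := ih b z hnd.2 hz.2 (Or.inr (Ne.symm hz.1))
        (fun x hx => haS x (List.mem_cons_of_mem _ hx)) hzS
      convert U.add_mem h1 h2 using 1
      simp only [List.cons_append, walkWeight]
      abel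
  obtain _ | ⟨a, _ | ⟨b, l⟩⟩ := c
  · simp at hc
  · simp at hc
  · rw [cycleWeight_cons]
    simpa using key (b :: l) a a hnd (List.nodup_cons.1 hnd).1 (by simp) hS (hS a (by simp))

end

/-- A zero-sum cycle on any vertex set of size at least `12 j k + 3`, where `k = dim V` and
`k (1 - 1/p)^(j+1) < 1/2`. -/
theorem exists_zeroSumCycle {p : ℕ} [Fact p.Prime] {X V : Type*} [Fintype X] [AddCommGroup V]
    [Module (ZMod p) V] [FiniteDimensional (ZMod p) V] {j : ℕ} (hj0 : 0 < j)
    (hj : finrank (ZMod p) V * (1 - 1 / (p : ℝ)) ^ (j + 1) < 1 / 2)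
    (hX : 12 * j * finrank (ZMod p) V + 3 ≤ Fintype.card X) (w : X → X → V) :
    ∃ c : List X, IsZeroSumCycle w c := by
  classical
  set k := finrank (ZMod p) V with hk
  have hl0 : 0 ≤ 1 - 1 / (p : ℝ) := by
    have hp : (2 : ℝ) ≤ p := by exact_mod_cast (Fact.out : p.Prime).two_le
    rw [sub_nonneg, div_le_one] <;> linarith
  have hex : ∃ d, ∃ (U : Submodule (ZMod p) V) (S : Finset X), finrank (ZMod p) U = d ∧
      S.card + 12 * j * d ≤ 12 * j * k ∧ ∀ g : Detour S, g.gain w ∈ U :=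
    ⟨k, ⊤, ∅, finrank_top _ _, by simp, fun g => Submodule.mem_top⟩
  -- Delete `12 j` vertices for each dimension dropped, so that all gains among the remaining
  -- vertices lie in `U`, with the dimension of `U` as small as possible.
  obtain ⟨U, S, hUd, hScard, hSU⟩ := Nat.find_spec hex
  have hmin : ∀ (U' : Submodule (ZMod p) V) (S' : Finset X),
      S'.card + 12 * j * finrank (ZMod p) U' ≤ 12 * j * k →
      (∀ g : Detour S', g.gain w ∈ U') → finrank (ZMod p) U ≤ finrank (ZMod p) U' :=
    fun U' S' h h' => hUd ▸ Nat.find_min' hex ⟨U', S', rfl, h, h'⟩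
  rw [← hUd] at hScard
  have hS3 : S.card + 3 ≤ Fintype.card X := by omega
  obtain ⟨φ, hφ⟩ := exists_potential hS3 hSU
  by_cases hU0 : U = ⊥
  · have hcompl : 1 < (Sᶜ : Finset X).card := by rw [Finset.card_compl]; omega
    obtain ⟨u, hu, v, hv, huv⟩ := Finset.one_lt_card.1 hcompl
    rw [Finset.mem_compl] at hu hv
    refine ⟨[u, v], by simp, by simpa using huv, ?_⟩
    have := cycleWeight_mem_of_potential hφ (c := [u, v]) (by simp) (by simpa using huv)
      (by simpa using ⟨hu, hv⟩)
    rwa [hU0, Submodule.mem_bot] at this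
  obtain ⟨G, hGdisj, hGspan⟩ := exists_disjoint_spanning_classes (K := ZMod p) (V := U)
    (vert := fun g : Detour S => g.support) (val := fun g => (⟨g.gain w, hSU g⟩ : U)) (r := 3)
    (fun g => Finset.card_le_three) (j + j) (fun U' T hU' hT => by
      -- Otherwise deleting `T` as well would replace `U` by the smaller subspace `U'`.
      by_contra! hno
      have hrank : finrank (ZMod p) (U'.map U.subtype) = finrank (ZMod p) U' :=
        Submodule.finrank_map_subtype_eq U U'
      have hquot := U'.finrank_quotient_add_finrank
      have hlt := Submodule.finrank_lt hU'.ne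
      have := hmin (U'.map U.subtype) (S ∪ T) (by
        have h1 := Finset.card_union_le S T
        rw [hrank]
        have h2 : 12 * j * finrank (ZMod p) U = 2 * 3 * (j + j) * finrank (ZMod p) (U ⧸ U') +
          12 * j * finrank (ZMod p) U' := by rw [← hquot]; ring
        omega) (fun g => by
        have hS' : ∀ x, x ∉ S ∪ T → x ∉ S := fun x hx h => hx (Finset.mem_union_left _ h)
        have hT' : ∀ x, x ∉ S ∪ T → x ∉ T := fun x hx h => hx (Finset.mem_union_right _ h)
        let g' : Detour S := ⟨g.src, g.mid, g.tgt, g.src_ne_mid, g.mid_ne_tgt, g.src_ne_tgt,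
          hS' _ g.src_notMem, hS' _ g.mid_notMem, hS' _ g.tgt_notMem⟩
        refine ⟨_, hno g' ?_, rfl⟩
        simp [g', Detour.support, hT' _ g.src_notMem, hT' _ g.mid_notMem, hT' _ g.tgt_notMem])
      omega)
  set d : Detour S × Fin (j + j) → U := fun i => ⟨i.1.gain w, hSU i.1⟩ with hd
  have hGne : G.toList ≠ [] := by
    intro h
    rw [Finset.toList_eq_nil] at h
    have h1 := hGspan ⟨0, by omega⟩
    rw [h] at h1
    have h2 : Nontrivial U := Submodule.nontrivial_iff_ne_bot.2 hU0
    simp at h1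
  have hlen : ∀ ε : Detour S × Fin (j + j) → Bool,
      2 ≤ (G.toList.flatMap fun i => i.1.route (ε i)).length := by
    intro ε
    obtain ⟨i, L, hL⟩ := List.exists_cons_of_ne_nil hGne
    rw [hL]
    cases h : ε i <;> simp [Detour.route, h]
  have hroute : ∀ (g : Detour S) (b : Bool), ∀ x ∈ g.route b, x ∈ g.support := by
    intro g b x hx
    cases b <;> simp [Detour.route, Detour.support] at hx ⊢ <;> tauto
  have hnd : ∀ ε : Detour S × Fin (j + j) → Bool,
      (G.toList.flatMap fun i => i.1.route (ε i)).Nodup := by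
    intro ε
    rw [List.nodup_flatMap]
    constructor
    · intro i _
      have h1 := i.1.src_ne_mid
      have h2 := i.1.mid_ne_tgt
      have h3 := i.1.src_ne_tgt
      cases ε i <;> simp [Detour.route, h1, h2, h3]
    · refine (Finset.nodup_toList G).pairwise_of_forall_ne fun i hi i' hi' hne x hx hx' => ?_
      exact Finset.disjoint_left.1
        (hGdisj (Finset.mem_toList.1 hi) (Finset.mem_toList.1 hi') hne)
        (hroute _ _ _ hx) (hroute _ _ _ hx')
  have hbase : cycleWeight w (G.toList.flatMap fun i => i.1.route false) ∈ U := by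
    refine cycleWeight_mem_of_potential hφ (hlen fun _ => false) (hnd fun _ => false) fun x hx => ?_
    obtain ⟨i, -, hxi⟩ := List.mem_flatMap.1 hx
    simp only [Detour.route, List.mem_cons, List.not_mem_nil, or_false] at hxi
    rcases hxi with rfl | rfl
    · exact i.1.src_notMem
    · exact i.1.tgt_notMem
  obtain ⟨E, hEG, hE⟩ := exists_subset_sum_eq (p := p) (d := d)
    (S := fun i : Fin (j + j) => G.filter fun g => g.2 = i)
    (fun i i' hne => Finset.disjoint_filter.2 fun g _ h h' => hne (h.symm.trans h'))
    (fun i => by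
      rw [eq_top_iff, ← hGspan i]
      refine Submodule.span_mono ?_
      rintro _ ⟨g, hg, rfl⟩
      exact ⟨(g, i), by simpa using hg, rfl⟩)
    (I := Finset.univ.map (Fin.castAddEmb j)) (J := Finset.univ.map (Fin.natAddEmb j))
    (by
      rw [Finset.disjoint_left]
      intro x hx hx'
      simp only [Finset.mem_map, Finset.mem_univ, true_and] at hx hx'
      obtain ⟨a, rfl⟩ := hx
      obtain ⟨b, hb⟩ := hx'
      have := congrArg Fin.val hb
      simp at this
      omega) (j := j) (by simp) (by simp)
    (lt_of_le_of_lt (by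
      have := Submodule.finrank_le U
      gcongr) hj) (-⟨_, hbase⟩)
  have hEG' : E ⊆ G := by
    refine hEG.trans (Finset.union_subset ?_ ?_) <;>
      exact Finset.biUnion_subset.2 fun i _ => Finset.filter_subset _ _
  refine ⟨G.toList.flatMap fun i => i.1.route (decide (i ∈ E)), hlen _, hnd _, ?_⟩
  have hsum : (G.toList.map fun i => if decide (i ∈ E) = true then i.1.gain w else 0).sum =
      ((∑ i ∈ E, d i : U) : V) := by
    rw [Finset.sum_map_toList]
    simp only [decide_eq_true_eq]
    rw [← Finset.sum_filter, Finset.filter_mem_eq_inter, Finset.inter_eq_right.2 hEG']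
    simp [hd]
  rw [cycleWeight_flatMap_route, hsum, hE]
  simp

/-! ### The bound for the zero-sum cycle number -/

theorem theorem1 (p : ℕ) (hp : p.Prime) (k : ℕ) (hk : 1 ≤ k) :
    ForcesZeroSumCycle (Fin k → ZMod p) (zeroSumCycleNumber (Fin k → ZMod p)) ∧
      (zeroSumCycleNumber (Fin k → ZMod p) : ℝ) ≤
        600 * (p : ℝ) * ((k : ℝ) * (Real.logb 2 (10 * (k : ℝ))) ^ 2) := by
  have : Fact p.Prime := ⟨hp⟩
  have hp2 : (2 : ℝ) ≤ p := by exact_mod_cast hp.two_le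
  have hk1 : (1 : ℝ) ≤ k := by exact_mod_cast hk
  have hlog0 : 0 < Real.log (2 * k) := Real.log_pos (by linarith)
  have hx0 : 0 < p * Real.log (2 * k) := by positivity
  set j := ⌈p * Real.log (2 * k)⌉₊ with hjdef
  have hj0 : 0 < j := Nat.ceil_pos.2 hx0
  have hjle : p * Real.log (2 * k) ≤ j := Nat.le_ceil _
  have hjlt : (j : ℝ) < p * Real.log (2 * k) + 1 := Nat.ceil_lt_add_one hx0.le
  have hj : (k : ℝ) * (1 - 1 / (p : ℝ)) ^ (j + 1) < 1 / 2 := by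
    have hl0 : 0 ≤ 1 - 1 / (p : ℝ) := by
      rw [sub_nonneg, div_le_one] <;> linarith
    have h1 : (1 - 1 / (p : ℝ)) ^ (j + 1) ≤ Real.exp (-((j + 1 : ℕ) / (p : ℝ))) := by
      calc _ ≤ Real.exp (-(1 / (p : ℝ))) ^ (j + 1) := by
            gcongr
            linarith [Real.add_one_le_exp (-(1 / (p : ℝ)))]
        _ = _ := by rw [← Real.exp_nat_mul]; congr 1; ring
    have h2 : Real.exp (-((j + 1 : ℕ) / (p : ℝ))) < Real.exp (-Real.log (2 * k)) := by
      rw [Real.exp_lt_exp, neg_lt_neg_iff, lt_div_iff₀ (by linarith)]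
      push_cast
      linarith
    rw [Real.exp_neg (Real.log _), Real.exp_log (by linarith)] at h2
    calc (k : ℝ) * (1 - 1 / (p : ℝ)) ^ (j + 1) < k * (2 * k : ℝ)⁻¹ := by
          have := h1.trans_lt h2
          gcongr
      _ = 1 / 2 := by field_simp
  have hforce : ForcesZeroSumCycle (Fin k → ZMod p) (12 * j * k + 3) := fun w =>
    exists_zeroSumCycle (p := p) hj0 (by simpa using hj) (by simp) w
  have hne : {n : ℕ | ForcesZeroSumCycle (Fin k → ZMod p) n}.Nonempty := ⟨_, hforce⟩
  refine ⟨Nat.sInf_mem hne, ?_⟩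
  have hle : zeroSumCycleNumber (Fin k → ZMod p) ≤ 12 * j * k + 3 := Nat.sInf_le hforce
  have hle' : (zeroSumCycleNumber (Fin k → ZMod p) : ℝ) ≤ 12 * j * k + 3 := by exact_mod_cast hle
  set Λ := Real.logb 2 (10 * (k : ℝ)) with hΛ
  have hΛ1 : 1 ≤ Λ := by
    rw [hΛ, Real.le_logb_iff_rpow_le (by norm_num) (by linarith)]
    norm_num
    linarith
  have hlogle : Real.log (2 * k) ≤ Λ := by
    have hlog2 : Real.log 2 ≤ 1 := by linarith [Real.log_two_lt_d9]
    have hlog2' : 0 < Real.log 2 := Real.log_pos (by norm_num)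
    rw [hΛ, Real.logb, le_div_iff₀ hlog2']
    calc Real.log (2 * k) * Real.log 2 ≤ Real.log (2 * k) * 1 := by gcongr
      _ ≤ Real.log (10 * k) := by
        rw [mul_one]
        exact Real.log_le_log (by linarith) (by linarith)
  have hpk : 1 ≤ (p : ℝ) * k := by nlinarith
  have hΛsq : Λ ≤ Λ ^ 2 := by nlinarith
  calc (zeroSumCycleNumber (Fin k → ZMod p) : ℝ) ≤ 12 * j * k + 3 := hle'
    _ ≤ 12 * (p * Λ + 1) * k + 3 := by
        have : (j : ℝ) ≤ p * Λ + 1 := hjlt.le.trans (by gcongr)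
        gcongr
    _ ≤ 600 * ((p * k) * Λ ^ 2) := by
        have h1 : (p : ℝ) * k * Λ ≤ p * k * Λ ^ 2 := by gcongr
        have h2 : (p : ℝ) * k * 1 ≤ p * k * Λ ^ 2 := by gcongr; linarith
        have h3 : (k : ℝ) ≤ p * k := by nlinarith
        nlinarith
    _ = _ := by ring
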